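/- For a real matrix $X\in\mathbb{R}^{p\times q}$ let $\sigma_1(X)\ge\sigma_2(X)\ge\cdots\ge\sigma_{\min(p,q)}(X)\ge 0$ be its singular values and ${\rm vol}(X)=\prod_{j=1}^{\min(p,q)}\sigma_j(X)$ its volume. A $p\times q$ submatrix $B$ of $A\in\mathbb{R}^{m\times n}$ is a local maximum volume submatrix if ${\rm vol}(B)>0$ and ${\rm vol}(B)\ge{\rm vol}(\hat B)$ for all $p\times q$ submatrices $\hat B$ of $A$ that differ from $B$ in at most one row and at most one column. A partial QR factorization of $A\in\mathbb{R}^{m\times n}$ after $k\le\min(m,n)$ steps is $$AP=\begin{bmatrix}Q_1&Q_2\end{bmatrix}\begin{bmatrix}R_{11}&R_{12}\\0&R_{22}\end{bmatrix},\qquad R_{12}\in\mathbb{R}^{k\times(n-k)},\quad R_{22}\in\mathbb{R}^{(\min(m,n)-k)\times(n-k)},$$ where $P$ is a permutation matrix, $R_{11}\in\mathbb{R}^{k\times k}$ is upper triangular, $Q_1\in\mathbb{R}^{m\times k}$ has orthonormal columns, and the remainder is orthogonal to $Q_1$, i.e. $Q_1^\top Q_2R_{22}=0$ (neither need $Q_2$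 have orthonormal columns nor $R_{22}$ be triangular). It gives the approximant $A_k=Q_1\begin{bmatrix}R_{11}&R_{12}\end{bmatrix}P^{-1}$. QR with local maximum volume pivoting, applied to $A$ and $1\le k\le\min(m,n)$, computes any such factorization in which the first $k$ columns of $AP$ form a local maximum volume $m\times k$ submatrix of $A$, and returns $A_k$; if $k>{\rm rank}(A)$, so that no $m\times k$ submatrix has positive volume, it stops after ${\rm rank}(A)$ columns and returns the approximant found with ${\rm rank}(A)$ in place of $k$. **Theorem.** QR with local maximum volume pivoting is a rank-revealer with $\mu_{m,n,k}=\sqrt{1+5kn}$. That is, $\mu_{m,n,k}\ge1$ is bounded by a polynomial in $m,n,k$, and for every $m,n$, every $A\in\mathbb{R}^{m\times n}$ and every $1\le k\le\min(m,n)$ the algorithm has an output, and each of its possible outputs $A_k$ has rank at most $k$ and satisfies $$\frac1{\mu_{m,n,k}}\sigma_j(A)\le\sigma_j(A_k)\le\mu_{m,n,k}\,\sigma_j(A),\qquad 1\le j\le k,$$ $$\frac1{\mu_{m,n,k}}\sigma_{k+j}(A)\le\sigma_j(A-A_k)\le\mu_{m,n,k}\,\sigma_{k+j}(A),\qquad 1\le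 j\le\min(m,n)-k.$$ Moreover, in every partial QR factorization of a matrix $A$ after any number $k$ of steps in which the first $k$ columns of $AP$ form a local maximum volume $m\times k$ submatrix of $A$, the block $R_{11}$ is invertible and the interpolative bound with $\nu=1$ holds: every entry of $R_{11}^{-1}R_{12}$ has absolute value at most $1$. -/

import Mathlib

noncomputable section

/-- The singular values of a real `m × n` matrix in nonincreasing order, counted from one:
`sv A 1 ≥ sv A 2 ≥ ⋯`. Only the values `sv A j` with `1 ≤ j ≤ min m n` are used below. -/
def sv {m n : ℕ} (A : Matrix (Fin m) (Fin n) ℝ) (j : ℕ) : ℝ :=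
  (Matrix.toEuclideanLin A).singularValues (j - 1)

/-- The volume of a matrix: the product of its `min m n` singular values. -/
def vol {m n : ℕ} (A : Matrix (Fin m) (Fin n) ℝ) : ℝ :=
  ∏ j ∈ Finset.Icc 1 (min m n), sv A j

/-- The `p × q` submatrix of `A` with rows `f` and columns `g` is a local maximum volume submatrix:
its volume is positive, and no `p × q` submatrix of `A` that differs from it in at most one row and
at most one column has a larger volume. Whether two submatrices differ is a matter of the
sets of selected rows and columns. -/
structure IsLocalMaxVol {m n p q : ℕ} (A : Matrix (Fin m) (Fin n) ℝ)
    (f : Fin p ↪ Fin m) (g : Fin q ↪ Fin n) : Prop where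
  vol_pos : 0 < vol (A.submatrix f g)
  vol_le : ∀ (f' : Fin p ↪ Fin m) (g' : Fin q ↪ Fin n),
    (Finset.univ.map f' \ Finset.univ.map f).card ≤ 1 →
    (Finset.univ.map g' \ Finset.univ.map g).card ≤ 1 →
    vol (A.submatrix f' g') ≤ vol (A.submatrix f g)

/-- A partial QR factorization of `A` after `k` steps,
`A P = [Q₁ Q₂] * [R₁₁ R₁₂; 0 R₂₂]`.

The permutation matrix `P` is given by the bijection `perm`, which lists the columns of `A` in two
blocks, the first `k` ones and the other `n - k` ones: the columns of `A P` are those of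
`A.submatrix id perm`. The columns of `Q₂` need not be orthonormal, and `R₂₂` need not be
triangular; but the remainder `Q₂ R₂₂` is what is left after the columns of `Q₁` have been
projected out, so it is orthogonal to `Q₁`. -/
structure PartialQR {m n : ℕ} (A : Matrix (Fin m) (Fin n) ℝ) (k : ℕ) where
  perm : Fin k ⊕ Fin (n - k) ≃ Fin n
  Q₁ : Matrix (Fin m) (Fin k) ℝ
  Q₂ : Matrix (Fin m) (Fin (min m n - k)) ℝ
  R₁₁ : Matrix (Fin k) (Fin k) ℝ
  R₁₂ : Matrix (Fin k) (Fin (n - k)) ℝ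
  R₂₂ : Matrix (Fin (min m n - k)) (Fin (n - k)) ℝ
  upper_triangular : ∀ i j : Fin k, j < i → R₁₁ i j = 0
  orthonormal : Q₁.transpose * Q₁ = 1
  orthogonal : Q₁.transpose * (Q₂ * R₂₂) = 0
  factorization : A.submatrix id perm =
    Matrix.fromCols Q₁ Q₂ * Matrix.fromBlocks R₁₁ R₁₂ 0 R₂₂

namespace PartialQR

/-- The low-rank approximation `A_k = Q₁ [R₁₁ R₁₂] P⁻¹`. -/
def approx {m n k : ℕ} {A : Matrix (Fin m) (Fin n) ℝ} (F : PartialQR A k) :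
    Matrix (Fin m) (Fin n) ℝ :=
  (F.Q₁ * Matrix.fromCols F.R₁₁ F.R₁₂).submatrix id F.perm.symm

/-- The column indices of `A` that become the first `k` columns of `A P`. -/
def pivotCols {m n k : ℕ} {A : Matrix (Fin m) (Fin n) ℝ} (F : PartialQR A k) :
    Fin k ↪ Fin n :=
  Function.Embedding.inl.trans F.perm.toEmbedding

/-- Local maximum volume pivoting: the first `k` columns of `A P` form a local maximum volume
`m × k` submatrix of `A`. -/
def HasLocalMaxVolPivot {m n k : ℕ} {A : Matrix (Fin m) (Fin n) ℝ} (F : PartialQR A k) : Prop :=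
  IsLocalMaxVol A (Function.Embedding.refl (Fin m)) F.pivotCols

/-- The interpolative bound `‖R₁₁⁻¹ R₁₂‖_max ≤ ν`, with `R₁₁` invertible. -/
def InterpolativeBound {m n k : ℕ} {A : Matrix (Fin m) (Fin n) ℝ} (F : PartialQR A k)
    (ν : ℝ) : Prop :=
  IsUnit F.R₁₁.det ∧ ∀ i j, |(F.R₁₁⁻¹ * F.R₁₂) i j| ≤ ν

end PartialQR

/-- The matrices that QR with local maximum volume pivoting may return for the input `A` and `k`.
The choice of a local maximum volume pivot and of the factorization is left open. For
`k ≤ A.rank` the pivot consists of `k` columns. For `k > A.rank` an `m × k` submatrix of positive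
volume does not exist, and the algorithm stops after `A.rank` columns. -/
def qrLocalMaxVol (m n : ℕ) (A : Matrix (Fin m) (Fin n) ℝ) (k : ℕ) :
    Set (Matrix (Fin m) (Fin n) ℝ) :=
  {B | ∃ F : PartialQR A (min k A.rank), F.HasLocalMaxVolPivot ∧ F.approx = B}

/-- An algorithm (given by its set of possible outputs `A_k` for every input `A` and `k`) is a
rank-revealer with factor `μ`: `μ` is bounded by a polynomial in `m`, `n`, `k`, and for every
matrix `A` of any size and `1 ≤ k ≤ min m n` the algorithm has an output, and each of its outputs
is a matrix of rank at most `k` whose singular values, and those of the residual `A - A_k`,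
agree with the leading and trailing singular values of `A` up to the factor `μ m n k ≥ 1`. -/
def IsRankRevealer
    (alg : ∀ m n : ℕ, Matrix (Fin m) (Fin n) ℝ → ℕ → Set (Matrix (Fin m) (Fin n) ℝ))
    (μ : ℕ → ℕ → ℕ → ℝ) : Prop :=
  (∃ p : MvPolynomial (Fin 3) ℝ, ∀ m n k : ℕ,
    μ m n k ≤ MvPolynomial.eval ![(m : ℝ), (n : ℝ), (k : ℝ)] p) ∧
  ∀ (m n : ℕ) (A : Matrix (Fin m) (Fin n) ℝ) (k : ℕ), 1 ≤ k → k ≤ min m n →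
    1 ≤ μ m n k ∧ (alg m n A k).Nonempty ∧
    ∀ B ∈ alg m n A k,
      B.rank ≤ k ∧
      (∀ j : ℕ, 1 ≤ j → j ≤ k →
        1 / μ m n k * sv A j ≤ sv B j ∧ sv B j ≤ μ m n k * sv A j) ∧
      (∀ j : ℕ, 1 ≤ j → j ≤ min m n - k →
        1 / μ m n k * sv A (k + j) ≤ sv (A - B) j ∧
        sv (A - B) j ≤ μ m n k * sv A (k + j))

end

/-!
Let `C` be the pivot columns of `A`. A partial QR factorization writes the other columns as
`C W + D` with `W = R₁₁⁻¹ R₁₂` and `Cᵀ D = 0`; the approximant `B` keeps `C W` and drops `D`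
(`InterpDecomp`, `PartialQR.toInterpDecomp`). The squared volume of `C` is the Gram determinant
`det (Cᵀ C)` (`vol_sq`), and exchanging column `i` of `C` for column `j` of `C W + D` multiplies it
by `W i j ^ 2 + ‖D_j‖² ‖C⁺_i‖²`, where `D_j` is a column of `D` and `C⁺_i` a row of the
pseudoinverse of `C`. Local maximality says that this factor is at most `1`
(`sq_add_mul_le_one_of_gram_le`), which contains the interpolative bound, and summing over all
exchanges gives `‖W‖² + ‖D‖² ‖C⁺‖² ≤ k (n - k)` in Frobenius norms (`InterpDecomp.total_bound`).

This is the situation of Gu and Eisenstat's strong rank-revealing QR, and the singular values are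
compared through the max-min principle (`le_sv_sq_of_subspace`, `exists_subspace_sv_sq_le`).
* As `‖A x‖² = ‖B x‖² + ‖(A - B) x‖²`, the inequality `σ_j(B) ≤ σ_j(A)` is immediate, and
  `σ_{k+j}(A) ≤ σ_j(A - B)` holds because `B` has rank at most `k`.
* `σ_j(A)² ≤ σ_j(B)² + ‖D‖²`, and `‖D‖² ≤ k (n - k) σ_k(B)²` since `σ_k(B) ≥ 1 / ‖C⁺‖`
  (`InterpDecomp.sv_sq_le_mul_sv_approx_sq`).
* For `σ_j(A - B)`, a `j`-dimensional space on which `A - B` is large is turned, together with the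
  `k` coordinates of the pivot columns, into a `(k + j)`-dimensional space on which `A` is large
  (`InterpDecomp.sv_sub_approx_sq_le`).

The resulting factor `√(1 + k (n - k))` is at most `√(1 + 5 k n)`. An output exists because a
selection of `min k A.rank` columns with maximal volume is a local maximum volume submatrix
(`exists_isLocalMaxVol`), and the Gram–Schmidt process together with a rank factorization of the
remainder yields a partial QR factorization with these pivots.
-/

/-! ### Variational characterization of singular values -/

theorem LinearMap.norm_sq_eq_sum_singularValues_sq_mul_inner_sq {E F : Type*} [NormedAddCommGroup E]
    [InnerProductSpace ℝ E] [FiniteDimensional ℝ E] [NormedAddCommGroup F] [InnerProductSpace ℝ F]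
    [FiniteDimensional ℝ F] (T : E →ₗ[ℝ] F) (x : E) :
    ‖T x‖ ^ 2 = ∑ i : Fin (Module.finrank ℝ E), T.singularValues i ^ 2 *
      inner ℝ (T.isSymmetric_adjoint_comp_self.eigenvectorBasis rfl i) x ^ 2 := by
  set b := T.isSymmetric_adjoint_comp_self.eigenvectorBasis rfl with hb
  have h1 : ‖T x‖ ^ 2 = inner ℝ x ((T.adjoint ∘ₗ T) x) := by
    rw [LinearMap.comp_apply, LinearMap.adjoint_inner_right, real_inner_self_eq_norm_sq]
  rw [h1, ← b.sum_inner_mul_inner]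
  refine Finset.sum_congr rfl fun i _ => ?_
  have h2 : inner ℝ (b i) ((T.adjoint ∘ₗ T) x) =
      T.singularValues i ^ 2 * inner ℝ (b i) x := by
    rw [← T.isSymmetric_adjoint_comp_self (b i) x, hb,
      LinearMap.IsSymmetric.apply_eigenvectorBasis, T.sq_singularValues_fin rfl i,
      real_inner_smul_left]
    simp
  rw [h2, real_inner_comm]
  ring

/-- The lower half of the max-min principle: a subspace of dimension greater than `j` meets the
orthogonal complement of the first `j` right singular vectors, where `‖T x‖ ≤ σ_j ‖x‖`. -/
theorem LinearMap.le_sq_singularValues_of_subspace {E F : Type*} [NormedAddCommGroup E]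
    [InnerProductSpace ℝ E] [FiniteDimensional ℝ E] [NormedAddCommGroup F] [InnerProductSpace ℝ F]
    [FiniteDimensional ℝ F] (T : E →ₗ[ℝ] F) (V : Submodule ℝ E) {j : ℕ}
    (hj : j < Module.finrank ℝ V) {c : ℝ} (h : ∀ x ∈ V, c * ‖x‖ ^ 2 ≤ ‖T x‖ ^ 2) :
    c ≤ T.singularValues j ^ 2 := by
  set b := T.isSymmetric_adjoint_comp_self.eigenvectorBasis rfl with hb
  have hjn : j < Module.finrank ℝ E := hj.trans_le V.finrank_le
  let φ : V →ₗ[ℝ] (Fin j → ℝ) :=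
    LinearMap.pi fun i => (innerₛₗ ℝ (b ⟨i, i.2.trans hjn⟩)).comp V.subtype
  obtain ⟨x, hx, hx0⟩ := Submodule.exists_mem_ne_zero_of_ne_bot
    (φ.ker_ne_bot_of_finrank_lt (by simpa using hj))
  have hz : ∀ i : Fin (Module.finrank ℝ E), (i : ℕ) < j → inner ℝ (b i) (x : E) = 0 := by
    intro i hi
    exact congrFun (LinearMap.mem_ker.1 hx) ⟨i, hi⟩
  have hle : ‖T x‖ ^ 2 ≤ T.singularValues j ^ 2 * ‖(x : E)‖ ^ 2 := by
    rw [T.norm_sq_eq_sum_singularValues_sq_mul_inner_sq, ← b.sum_sq_inner_right, Finset.mul_sum]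
    refine Finset.sum_le_sum fun i _ => ?_
    by_cases hi : (i : ℕ) < j
    · rw [← hb, hz i hi]; simp
    · exact mul_le_mul_of_nonneg_right (pow_le_pow_left₀ (T.singularValues_nonneg _)
        (T.singularValues_antitone (not_lt.1 hi)) 2) (sq_nonneg _)
  have hpos : 0 < ‖(x : E)‖ ^ 2 := by
    have : (x : E) ≠ 0 := by simpa using hx0
    positivity
  exact le_of_mul_le_mul_right ((h x x.2).trans hle) hpos

/-- The max-min principle is attained on the span of the first `j + 1` right singular vectors. -/
theorem LinearMap.exists_subspace_sq_singularValues_le {E F : Type*} [NormedAddCommGroup E]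
    [InnerProductSpace ℝ E] [FiniteDimensional ℝ E] [NormedAddCommGroup F] [InnerProductSpace ℝ F]
    [FiniteDimensional ℝ F] (T : E →ₗ[ℝ] F) {j : ℕ} (hj : j < Module.finrank ℝ E) :
    ∃ V : Submodule ℝ E, Module.finrank ℝ V = j + 1 ∧
      ∀ x ∈ V, T.singularValues j ^ 2 * ‖x‖ ^ 2 ≤ ‖T x‖ ^ 2 := by
  set b := T.isSymmetric_adjoint_comp_self.eigenvectorBasis rfl with hb
  let v : Fin (j + 1) → E := fun i => b (Fin.castLE hj i)
  refine ⟨Submodule.span ℝ (Set.range v), ?_, fun x hx => ?_⟩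
  · have hli : LinearIndependent ℝ v :=
      (b.orthonormal.comp _ (Fin.castLE_injective hj)).linearIndependent
    rw [finrank_span_eq_card hli, Fintype.card_fin]
  · have hz : ∀ i : Fin (Module.finrank ℝ E), j < (i : ℕ) → inner ℝ (b i) x = 0 := by
      intro i hi
      refine Submodule.span_induction (p := fun y _ => inner ℝ (b i) y = 0) ?_ ?_ ?_ ?_ hx
      · rintro _ ⟨l, rfl⟩
        refine b.orthonormal.2 fun h => ?_
        have := congrArg Fin.val h
        simp at this
        omega
      · simp
      · intro y z _ _ hy hz
        rw [inner_add_right, hy, hz, add_zero]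
      · intro a y _ hy
        rw [real_inner_smul_right, hy, mul_zero]
    rw [T.norm_sq_eq_sum_singularValues_sq_mul_inner_sq, ← b.sum_sq_inner_right, Finset.mul_sum]
    refine Finset.sum_le_sum fun i _ => ?_
    by_cases hi : j < (i : ℕ)
    · rw [← hb, hz i hi]; simp
    · exact mul_le_mul_of_nonneg_right (pow_le_pow_left₀ (T.singularValues_nonneg _)
        (T.singularValues_antitone (not_lt.1 hi)) 2) (sq_nonneg _)


open Matrix

theorem norm_toEuclideanLin_sq {m n : ℕ} (A : Matrix (Fin m) (Fin n) ℝ)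
    (x : EuclideanSpace ℝ (Fin n)) :
    ‖Matrix.toEuclideanLin A x‖ ^ 2 = (A *ᵥ x.ofLp) ⬝ᵥ (A *ᵥ x.ofLp) := by
  rw [EuclideanSpace.real_norm_sq_eq]
  simp [dotProduct, sq]

theorem sv_nonneg {m n : ℕ} (A : Matrix (Fin m) (Fin n) ℝ) (j : ℕ) : 0 ≤ sv A j :=
  LinearMap.singularValues_nonneg _ _

theorem sv_antitone {m n : ℕ} (A : Matrix (Fin m) (Fin n) ℝ) : Antitone (sv A) :=
  fun _ _ h => LinearMap.singularValues_antitone _ (Nat.sub_le_sub_right h 1)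

theorem le_sv_sq_of_subspace {m n : ℕ} (A : Matrix (Fin m) (Fin n) ℝ)
    (V : Submodule ℝ (Fin n → ℝ)) {j : ℕ} (hj : 1 ≤ j) (hV : j ≤ Module.finrank ℝ V) {c : ℝ}
    (h : ∀ x ∈ V, c * (x ⬝ᵥ x) ≤ (A *ᵥ x) ⬝ᵥ (A *ᵥ x)) : c ≤ sv A j ^ 2 := by
  let e := (WithLp.linearEquiv 2 ℝ (Fin n → ℝ)).symm
  refine LinearMap.le_sq_singularValues_of_subspace _ (V.map (e : _ →ₗ[ℝ] _)) ?_ ?_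
  · rw [LinearEquiv.finrank_map_eq]; omega
  · rintro _ ⟨x, hx, rfl⟩
    rw [norm_toEuclideanLin_sq, EuclideanSpace.real_norm_sq_eq]
    simpa [e, dotProduct, sq] using h x hx

theorem exists_subspace_sv_sq_le {m n : ℕ} (A : Matrix (Fin m) (Fin n) ℝ) {j : ℕ} (hj : 1 ≤ j)
    (hjn : j ≤ n) : ∃ V : Submodule ℝ (Fin n → ℝ), Module.finrank ℝ V = j ∧
      ∀ x ∈ V, sv A j ^ 2 * (x ⬝ᵥ x) ≤ (A *ᵥ x) ⬝ᵥ (A *ᵥ x) := by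
  let e := WithLp.linearEquiv 2 ℝ (Fin n → ℝ)
  obtain ⟨V, hV, h⟩ := (Matrix.toEuclideanLin A).exists_subspace_sq_singularValues_le
    (j := j - 1) (by simp; omega)
  refine ⟨V.map (e : _ →ₗ[ℝ] _), ?_, ?_⟩
  · rw [LinearEquiv.finrank_map_eq]; omega
  · rintro _ ⟨x, hx, rfl⟩
    have := h x hx
    rw [norm_toEuclideanLin_sq, EuclideanSpace.real_norm_sq_eq] at this
    simpa [e, dotProduct, sq, sv] using this

theorem sv_eq_zero_of_rank_lt {m n : ℕ} (A : Matrix (Fin m) (Fin n) ℝ) {j : ℕ} (h : A.rank < j) :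
    sv A j = 0 := by
  rw [sv, LinearMap.singularValues_eq_zero_iff_le_finrank_range,
    toEuclideanLin_eq_toLin_orthonormal, ← Matrix.rank_eq_finrank_range_toLin]
  omega

/-! ### Volume and Gram determinants -/

theorem vol_nonneg {m n : ℕ} (A : Matrix (Fin m) (Fin n) ℝ) : 0 ≤ vol A :=
  Finset.prod_nonneg fun _ _ => sv_nonneg _ _

theorem vol_sq {m k : ℕ} (hk : k ≤ m) (C : Matrix (Fin m) (Fin k) ℝ) :
    vol C ^ 2 = (Cᵀ * C).det := by
  have h1 : vol C = (Matrix.toEuclideanLin C).normDet := by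
    rw [LinearMap.normDet_eq_prod_singularValues, vol, min_eq_right hk,
      ← Finset.Ico_add_one_right_eq_Icc, Finset.prod_Ico_eq_prod_range]
    simp [sv]
  have h2 := (Matrix.toEuclideanLin C).normDet_sq
  rw [h1]
  refine h2.trans ?_
  rw [← Matrix.toEuclideanLin_conjTranspose_eq_adjoint, conjTranspose_eq_transpose_of_trivial,
    toEuclideanLin_eq_toLin_orthonormal, toEuclideanLin_eq_toLin_orthonormal, 
    ← Matrix.toLin_mul, LinearMap.det_toLin]

/-! ### Column exchanges -/

theorem adjugate_eq_det_updateCol {k : ℕ} (X : Matrix (Fin k) (Fin k) ℝ) (i j : Fin k) :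
    X.adjugate i j = (X.updateCol i (Pi.single j 1)).det := by
  rw [← transpose_apply X.adjugate, adjugate_transpose, adjugate_apply, updateRow_transpose,
    det_transpose]

theorem det_one_updateCol {k : ℕ} (i : Fin k) (w : Fin k → ℝ) :
    ((1 : Matrix (Fin k) (Fin k) ℝ).updateCol i w).det = w i := by
  rw [← cramer_apply, cramer_one, Module.End.one_apply]

theorem adjugate_one_updateCol_row {k : ℕ} (i : Fin k) (w : Fin k → ℝ) (j : Fin k) :
    ((1 : Matrix (Fin k) (Fin k) ℝ).updateCol i w).adjugate i j =
      (1 : Matrix (Fin k) (Fin k) ℝ) i j := by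
  rw [adjugate_eq_det_updateCol, updateCol_idem, det_one_updateCol, one_apply, Pi.single_apply]

/-- With `M` the identity whose column `i` is replaced by `w`, the `(i, i)` cofactor of `Mᵀ G M` is
that of `G`, so adding `t` to the `(i, i)` entry of `Mᵀ G M` adds `t * G.det * G⁻¹ i i` to its
determinant. -/
theorem det_conj_add_single {k : ℕ} (G : Matrix (Fin k) (Fin k) ℝ) (i : Fin k) (w : Fin k → ℝ)
    (t : ℝ) (hG : IsUnit G.det) :
    (((1 : Matrix (Fin k) (Fin k) ℝ).updateCol i w)ᵀ * G *
      (1 : Matrix (Fin k) (Fin k) ℝ).updateCol i w + single i i t).det =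
      G.det * (w i ^ 2 + t * G⁻¹ i i) := by
  set M := (1 : Matrix (Fin k) (Fin k) ℝ).updateCol i w with hM
  set X := Mᵀ * G * M with hX
  have hdet : M.det = w i := det_one_updateCol i w
  have hadj : X.adjugate i i = G.adjugate i i := by
    rw [hX, adjugate_mul_distrib, adjugate_mul_distrib, ← adjugate_transpose, ← Matrix.mul_assoc]
    simp [Matrix.mul_apply, hM, adjugate_one_updateCol_row, one_apply]
  have hsplit : X + single i i t = X.updateCol i ((fun r => X r i) + t • Pi.single i 1) := by
    ext r c
    by_cases hc : c = i
    · subst hc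
      by_cases hr : r = c
      · subst hr; simp
      · simp [hr, Ne.symm hr]
    · simp [hc, Ne.symm hc]
  have hinv : G.det * G⁻¹ i i = G.adjugate i i := by
    rw [inv_def, Matrix.smul_apply, smul_eq_mul, ← mul_assoc, Ring.mul_inverse_cancel _ hG, one_mul]
  rw [hsplit, det_updateCol_add, det_updateCol_smul, updateCol_eq_self, mul_add]
  rw [← adjugate_eq_det_updateCol, hadj, mul_left_comm, hinv, hX]
  simp only [det_mul, det_transpose, hdet]
  ring

/-- Exchanging column `i` of `C` for `C w + d`, with `d` orthogonal to the columns of `C`, changes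
the Gram matrix by a congruence and by `‖d‖²` on one diagonal entry. -/
theorem gram_updateCol {m k : ℕ} (C : Matrix (Fin m) (Fin k) ℝ) (i : Fin k)
    (w : Fin k → ℝ) (d : Fin m → ℝ) (h : Cᵀ *ᵥ d = 0) :
    (C.updateCol i (C *ᵥ w + d))ᵀ * C.updateCol i (C *ᵥ w + d) =
      ((1 : Matrix (Fin k) (Fin k) ℝ).updateCol i w)ᵀ * (Cᵀ * C) *
      (1 : Matrix (Fin k) (Fin k) ℝ).updateCol i w + single i i (d ⬝ᵥ d) := by
  have h1 : C.updateCol i (C *ᵥ w + d) =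
      C * (1 : Matrix (Fin k) (Fin k) ℝ).updateCol i w + vecMulVec d (Pi.single i 1) := by
    ext r c
    by_cases hc : c = i
    · subst hc; simp [vecMulVec_apply, mul_apply, mulVec, dotProduct]
    · simp [vecMulVec_apply, mul_apply, hc, one_apply]
  have h2 : Cᵀ * vecMulVec d (Pi.single i 1) = 0 := by
    rw [mul_vecMulVec, h, zero_vecMulVec]
  have h3 : (vecMulVec d (Pi.single i 1))ᵀ * C = 0 := by
    rw [← transpose_inj, transpose_mul, transpose_transpose, h2, transpose_zero]
  have h4 : (vecMulVec d (Pi.single i (1 : ℝ)))ᵀ * vecMulVec d (Pi.single i 1) =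
      single i i (d ⬝ᵥ d) := by
    rw [transpose_vecMulVec, vecMulVec_mul_vecMulVec]
    ext r c
    simp [vecMulVec_apply, single_apply, Pi.single_apply]
    grind
  rw [h1, transpose_add, transpose_mul, Matrix.add_mul, Matrix.mul_add, Matrix.mul_add, h4,
    Matrix.mul_assoc _ Cᵀ, ← Matrix.mul_assoc, Matrix.mul_assoc _ _ (vecMulVec _ _), h2,
    ← Matrix.mul_assoc (vecMulVec _ _)ᵀ, h3]
  simp [Matrix.mul_assoc]

/-- The operator norm of a matrix is at most its Frobenius norm. -/
theorem mulVec_dot_self_le {m n : ℕ} (M : Matrix (Fin m) (Fin n) ℝ) (x : Fin n → ℝ) :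
    (M *ᵥ x) ⬝ᵥ (M *ᵥ x) ≤ (∑ i, ∑ j, M i j ^ 2) * (x ⬝ᵥ x) := by
  rw [dotProduct, Finset.sum_mul]
  refine Finset.sum_le_sum fun i _ => ?_
  rw [← sq]
  simpa [mulVec, dotProduct, sq] using Finset.sum_mul_sq_le_sq_mul_sq Finset.univ (M i) x

/-- If exchanging column `i` of `C` for column `j` of `C W + D` does not increase the volume, then
`W i j` and the product of the norms of column `j` of `D` and row `i` of the pseudoinverse of `C`
are jointly bounded: the left-hand side is the squared ratio of the two volumes. -/
theorem sq_add_mul_le_one_of_gram_le {m k l : ℕ} {C : Matrix (Fin m) (Fin k) ℝ}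
    {D : Matrix (Fin m) (Fin l) ℝ} {W : Matrix (Fin k) (Fin l) ℝ} (hCD : Cᵀ * D = 0)
    (hG : 0 < (Cᵀ * C).det) (i : Fin k) (j : Fin l)
    (h : ((C.updateCol i ((C * W + D).col j))ᵀ * C.updateCol i ((C * W + D).col j)).det ≤
      (Cᵀ * C).det) :
    W i j ^ 2 + (∑ r, D r j ^ 2) * (∑ s, ((Cᵀ * C)⁻¹ * Cᵀ) i s ^ 2) ≤ 1 := by
  have hcol : (C * W + D).col j = C *ᵥ W.col j + D.col j := by
    ext r; simp [mul_apply, mulVec, dotProduct]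
  have hd : Cᵀ *ᵥ D.col j = 0 := by
    ext r; exact congrFun (congrFun hCD r) j
  have hL : ∑ s, ((Cᵀ * C)⁻¹ * Cᵀ) i s ^ 2 = (Cᵀ * C)⁻¹ i i := by
    have : ((Cᵀ * C)⁻¹ * Cᵀ) * ((Cᵀ * C)⁻¹ * Cᵀ)ᵀ = (Cᵀ * C)⁻¹ := by
      rw [transpose_mul, transpose_transpose, transpose_nonsing_inv, transpose_mul,
        transpose_transpose, Matrix.mul_assoc, ← Matrix.mul_assoc Cᵀ,
        Matrix.mul_nonsing_inv _ hG.ne'.isUnit, Matrix.mul_one]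
    refine Eq.trans ?_ (congrFun (congrFun this i) i)
    rw [Matrix.mul_apply]
    simp only [transpose_apply, sq]
  rw [hcol, gram_updateCol _ _ _ _ hd, det_conj_add_single _ _ _ _ hG.ne'.isUnit] at h
  rw [hL]
  have := le_of_mul_le_mul_left (h.trans_eq (mul_one _).symm) hG
  simpa [dotProduct, sq] using this

/-! ### Comparison of singular values -/

theorem sv_le_sv_of_mulVec_le {m n p : ℕ} {A : Matrix (Fin m) (Fin n) ℝ}
    {B : Matrix (Fin p) (Fin n) ℝ} (h : ∀ x, (B *ᵥ x) ⬝ᵥ (B *ᵥ x) ≤ (A *ᵥ x) ⬝ᵥ (A *ᵥ x)) {j : ℕ}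
    (hj : 1 ≤ j) (hjn : j ≤ n) : sv B j ≤ sv A j := by
  obtain ⟨V, hV, hVB⟩ := exists_subspace_sv_sq_le B hj hjn
  exact le_of_sq_le_sq (le_sv_sq_of_subspace A V hj hV.ge fun x hx => (hVB x hx).trans (h x))
    (sv_nonneg _ _)

/-- Subtracting a matrix of rank at most `r` from `A` moves the singular values of `A` by at most
`r` places: the kernel of `B` meets every subspace of dimension `r + j` in dimension at least
`j`. -/
theorem sv_add_rank_le {m n : ℕ} (A B : Matrix (Fin m) (Fin n) ℝ) {j r : ℕ}
    (hr : B.rank ≤ r) (hj : 1 ≤ j) (hjn : r + j ≤ n) : sv A (r + j) ≤ sv (A - B) j := by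
  obtain ⟨V, hV, hVA⟩ := exists_subspace_sv_sq_le A (hj.trans (Nat.le_add_left j r)) hjn
  have hdim := Submodule.finrank_sup_add_finrank_inf_eq V (LinearMap.ker B.mulVecLin)
  have hsup := (V ⊔ LinearMap.ker B.mulVecLin).finrank_le
  have hker := LinearMap.finrank_range_add_finrank_ker B.mulVecLin
  rw [← Matrix.rank, Module.finrank_fin_fun] at hker
  rw [Module.finrank_fin_fun] at hsup
  refine le_of_sq_le_sq (le_sv_sq_of_subspace (A - B) (V ⊓ LinearMap.ker B.mulVecLin) hj ?_
    fun x hx => ?_) (sv_nonneg _ _)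
  · omega
  · have hx2 : B *ᵥ x = 0 := hx.2
    rw [sub_mulVec, hx2, sub_zero]
    exact hVA x hx.1

theorem dot_self_nonneg {ι : Type*} [Fintype ι] (x : ι → ℝ) : 0 ≤ x ⬝ᵥ x :=
  Finset.sum_nonneg fun _ _ => mul_self_nonneg _

theorem dot_mul_dot_le {ι : Type*} [Fintype ι] (x y : ι → ℝ) :
    (x ⬝ᵥ y) ^ 2 ≤ (x ⬝ᵥ x) * (y ⬝ᵥ y) := by
  simpa [dotProduct, sq] using Finset.sum_mul_sq_le_sq_mul_sq Finset.univ x y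

/-! ### Interpolative decompositions -/

/-- An interpolative decomposition `A P = [C, C W + D]`: the other columns of `A` are linear
combinations of the columns of `C`, with coefficients `W`, up to a remainder `D` orthogonal to
`C`. As in `PartialQR`, the permutation `P` is given by the bijection `perm`. -/
structure InterpDecomp {m n : ℕ} (A : Matrix (Fin m) (Fin n) ℝ) (k l : ℕ) where
  perm : Fin k ⊕ Fin l ≃ Fin n
  C : Matrix (Fin m) (Fin k) ℝ
  W : Matrix (Fin k) (Fin l) ℝ
  D : Matrix (Fin m) (Fin l) ℝ
  orth : Cᵀ * D = 0
  eq : A.submatrix id perm = fromCols C (C * W + D)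

namespace InterpDecomp

variable {m n k l : ℕ} {A : Matrix (Fin m) (Fin n) ℝ} (F : InterpDecomp A k l)

/-- The approximant `C [1, W] P⁻¹`, which drops the remainder. -/
def approx : Matrix (Fin m) (Fin n) ℝ := (F.C * fromCols 1 F.W).submatrix id F.perm.symm

/-- The coordinates of a vector that belong to the columns in `C`. -/
def fst (x : Fin n → ℝ) : Fin k → ℝ := fun i => x (F.perm (Sum.inl i))

/-- The coordinates of a vector that belong to the columns outside `C`. -/
def snd (x : Fin n → ℝ) : Fin l → ℝ := fun i => x (F.perm (Sum.inr i))

theorem dotProduct_eq_add (x y : Fin n → ℝ) : x ⬝ᵥ y = F.fst x ⬝ᵥ F.fst y + F.snd x ⬝ᵥ F.snd y := by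
  simp only [dotProduct, fst, snd]
  rw [← F.perm.sum_comp, Fintype.sum_sum_type]

theorem submatrix_symm_mulVec (X : Matrix (Fin m) (Fin k ⊕ Fin l) ℝ) (x : Fin n → ℝ) :
    X.submatrix id F.perm.symm *ᵥ x = X *ᵥ (Sum.elim (F.fst x) (F.snd x)) := by
  have h : (Sum.elim (F.fst x) (F.snd x)) = x ∘ F.perm := by
    ext (i | i) <;> rfl
  rw [submatrix_mulVec_equiv, h]
  simp

theorem approx_mulVec (x : Fin n → ℝ) : F.approx *ᵥ x = F.C *ᵥ (F.fst x + F.W *ᵥ F.snd x) := by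
  rw [approx, submatrix_symm_mulVec, ← mulVec_mulVec, fromCols_mulVec_sumElim, one_mulVec]

theorem mulVec_eq (x : Fin n → ℝ) :
    A *ᵥ x = F.C *ᵥ (F.fst x + F.W *ᵥ F.snd x) + F.D *ᵥ F.snd x := by
  have hA : A = (fromCols F.C (F.C * F.W + F.D)).submatrix id F.perm.symm := by
    rw [← F.eq]; simp
  conv_lhs => rw [hA]
  rw [submatrix_symm_mulVec, fromCols_mulVec_sumElim, add_mulVec, mulVec_add, mulVec_mulVec,
    add_assoc]

theorem sub_approx_mulVec (x : Fin n → ℝ) : (A - F.approx) *ᵥ x = F.D *ᵥ F.snd x := by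
  rw [sub_mulVec, mulVec_eq F, approx_mulVec, add_sub_cancel_left]

theorem dotProduct_C_D (y : Fin k → ℝ) (z : Fin l → ℝ) : (F.C *ᵥ y) ⬝ᵥ (F.D *ᵥ z) = 0 := by
  rw [dotProduct_mulVec, vecMul_mulVec, F.orth, vecMul_zero, zero_dotProduct]

/-- Pythagoras: the approximant and the residual have orthogonal ranges. -/
theorem mulVec_dot_self (x : Fin n → ℝ) : (A *ᵥ x) ⬝ᵥ (A *ᵥ x) =
    (F.approx *ᵥ x) ⬝ᵥ (F.approx *ᵥ x) + ((A - F.approx) *ᵥ x) ⬝ᵥ ((A - F.approx) *ᵥ x) := by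
  rw [sub_approx_mulVec, approx_mulVec, F.mulVec_eq, add_dotProduct, dotProduct_add, dotProduct_add,
    dotProduct_C_D, dotProduct_comm (F.D *ᵥ _) (F.C *ᵥ _), dotProduct_C_D, zero_add, add_zero]

theorem le_mul_dot_of_leftInverse {L : Matrix (Fin k) (Fin m) ℝ} (hL : L * F.C = 1)
    (z : Fin k → ℝ) :
    z ⬝ᵥ z ≤ (∑ i, ∑ s, L i s ^ 2) * ((F.C *ᵥ z) ⬝ᵥ (F.C *ᵥ z)) := by
  have := mulVec_dot_self_le L (F.C *ᵥ z)
  rwa [mulVec_mulVec, hL, one_mulVec] at this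

/-- The map `(z, x) ↦ P (α z - W x₂, x₂)`, where `x₂ = F.snd x`. It is built so that `A` sends it
to `α C z + (A - F.approx) x`, a sum of two orthogonal vectors. -/
def lift (F : InterpDecomp A k l) (α : ℝ) :
    ((Fin k → ℝ) × (Fin n → ℝ)) →ₗ[ℝ] (Fin n → ℝ) where
  toFun p := fun i => Sum.elim (α • p.1 - F.W *ᵥ F.snd p.2) (F.snd p.2) (F.perm.symm i)
  map_add' p q := by
    ext i
    have : F.snd (p.2 + q.2) = F.snd p.2 + F.snd q.2 := rfl
    obtain ⟨s | s, rfl⟩ := F.perm.surjective i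
    · simp [this, mulVec_add]; ring
    · simp [this]
  map_smul' a p := by
    ext i
    have : F.snd (a • p.2) = a • F.snd p.2 := rfl
    obtain ⟨s | s, rfl⟩ := F.perm.surjective i
    · simp [this, mulVec_smul]; ring
    · simp [this]

theorem fst_lift (α : ℝ) (z : Fin k → ℝ) (x : Fin n → ℝ) :
    F.fst (F.lift α (z, x)) = α • z - F.W *ᵥ F.snd x := by
  ext i; simp [fst, lift]

theorem snd_lift (α : ℝ) (z : Fin k → ℝ) (x : Fin n → ℝ) :
    F.snd (F.lift α (z, x)) = F.snd x := by
  ext i; simp [snd, lift]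

/-- The squared norm of the block matrix `[α, -W; 0, 1]` is at most `1 + (α² + ‖W‖²)`. -/
theorem lift_dot_self_le (α : ℝ) (z : Fin k → ℝ) (x : Fin n → ℝ) :
    F.lift α (z, x) ⬝ᵥ F.lift α (z, x) ≤
      (1 + (α ^ 2 + ∑ i, ∑ j, F.W i j ^ 2)) * (z ⬝ᵥ z + x ⬝ᵥ x) := by
  set ω := ∑ i, ∑ j, F.W i j ^ 2 with hω
  have hω0 : 0 ≤ ω := by positivity
  rw [F.dotProduct_eq_add (F.lift α (z, x)), fst_lift, snd_lift]
  have hx3 : F.snd x ⬝ᵥ F.snd x ≤ x ⬝ᵥ x := by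
    rw [F.dotProduct_eq_add x x]; linarith [dot_self_nonneg (F.fst x)]
  have hw := mulVec_dot_self_le F.W (F.snd x)
  rw [← hω] at hw
  set v := F.W *ᵥ F.snd x
  set q := F.snd x ⬝ᵥ F.snd x
  have hq0 : 0 ≤ q := dot_self_nonneg _
  have hp0 : 0 ≤ z ⬝ᵥ z := dot_self_nonneg z
  set p := z ⬝ᵥ z
  have hexp : (α • z - v) ⬝ᵥ (α • z - v) = α ^ 2 * p - 2 * (α * (z ⬝ᵥ v)) + v ⬝ᵥ v := by
    simp only [sub_dotProduct, dotProduct_sub, smul_dotProduct, dotProduct_smul, smul_eq_mul,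
      dotProduct_comm v z, p]
    ring
  have hcs : (z ⬝ᵥ v) ^ 2 ≤ p * (ω * q) :=
    (dot_mul_dot_le z v).trans (mul_le_mul_of_nonneg_left hw hp0)
  have hcross : |2 * (α * (z ⬝ᵥ v))| ≤ α ^ 2 * q + ω * p := by
    refine abs_le_of_sq_le_sq ?_ (by positivity)
    nlinarith [sq_nonneg (α ^ 2 * q - ω * p), mul_le_mul_of_nonneg_left hcs (sq_nonneg α)]
  have hcross' := (abs_le.1 hcross).1
  have : 0 ≤ (1 + (α ^ 2 + ω)) * (x ⬝ᵥ x - q) := by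
    exact mul_nonneg (by positivity) (sub_nonneg.2 hx3)
  rw [hexp]
  nlinarith

theorem mulVec_lift_dot_self (α : ℝ) (z : Fin k → ℝ) (x : Fin n → ℝ) :
    (A *ᵥ F.lift α (z, x)) ⬝ᵥ (A *ᵥ F.lift α (z, x)) =
      α ^ 2 * ((F.C *ᵥ z) ⬝ᵥ (F.C *ᵥ z)) +
        ((A - F.approx) *ᵥ x) ⬝ᵥ ((A - F.approx) *ᵥ x) := by
  rw [F.mulVec_dot_self, sub_approx_mulVec, sub_approx_mulVec, approx_mulVec, fst_lift, snd_lift,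
    sub_add_cancel, mulVec_smul, smul_dotProduct, dotProduct_smul, smul_eq_mul, smul_eq_mul]
  ring

/-- The leading singular values of `A` are controlled by those of the approximant: the residual
contributes at most `‖D‖²` to `‖A x‖²`, and `‖D‖² ≤ κ σ_k(F.approx)²`. -/
theorem sv_sq_le_mul_sv_approx_sq {L : Matrix (Fin k) (Fin m) ℝ} (hL : L * F.C = 1) {κ : ℝ}
    (hκ : (∑ i, ∑ j, F.D i j ^ 2) * (∑ i, ∑ s, L i s ^ 2) ≤ κ) {j : ℕ}
    (hj : 1 ≤ j) (hjk : j ≤ k) : sv A j ^ 2 ≤ (1 + κ) * sv F.approx j ^ 2 := by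
  have hkn : k ≤ n := by
    have := Fintype.card_congr F.perm
    simp at this; omega
  set δ := ∑ i, ∑ j, F.D i j ^ 2 with hδ
  set ρ := ∑ i, ∑ s, L i s ^ 2 with hρ
  have hδ0 : 0 ≤ δ := by positivity
  have hρ0 : 0 ≤ ρ := by positivity
  -- On the coordinate space of the columns in `C`, the approximant acts as `C`, which is bounded
  -- below by `1 / √ρ`.
  have h1 : δ ≤ κ * sv F.approx k ^ 2 := by
    have hk : 0 < k := by omega
    have hρpos : 0 < ρ := by
      have := F.le_mul_dot_of_leftInverse hL (Pi.single ⟨0, hk⟩ 1)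
      simp only [dotProduct_single, Pi.single_eq_same, mul_one, ← hρ] at this
      by_contra! hc
      rw [le_antisymm hc hρ0] at this
      linarith
    have hfst : ∀ y, F.fst (F.lift 1 (y, 0)) = y := by
      intro y
      rw [fst_lift, show F.snd 0 = 0 from rfl, mulVec_zero, one_smul, sub_zero]
    have hinj : Function.Injective (F.lift 1 ∘ₗ LinearMap.inl ℝ _ _) := by
      intro y z h
      rw [← hfst y, ← hfst z]
      exact congrArg F.fst h
    have h : 1 / ρ ≤ sv F.approx k ^ 2 := by
      refine le_sv_sq_of_subspace _ (LinearMap.range (F.lift 1 ∘ₗ LinearMap.inl ℝ _ _)) hk ?_ ?_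
      · rw [LinearMap.finrank_range_of_inj hinj, Module.finrank_fin_fun]
      · rintro _ ⟨y, rfl⟩
        have hsnd : F.snd (F.lift 1 (y, 0)) = 0 := F.snd_lift 1 y 0
        rw [LinearMap.comp_apply, LinearMap.inl_apply, approx_mulVec, F.dotProduct_eq_add, hsnd,
          hfst, mulVec_zero, add_zero, dotProduct_zero, add_zero, div_mul_eq_mul_div,
          div_le_iff₀ hρpos, one_mul, mul_comm]
        exact F.le_mul_dot_of_leftInverse hL y
    rw [div_le_iff₀ hρpos] at h
    have := mul_le_mul_of_nonneg_right hκ (sq_nonneg (sv F.approx k))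
    have := mul_le_mul_of_nonneg_left h hδ0
    linarith
  have h2 : sv F.approx k ^ 2 ≤ sv F.approx j ^ 2 :=
    pow_le_pow_left₀ (sv_nonneg _ _) (sv_antitone _ hjk) 2
  have hκ0 : 0 ≤ κ := (mul_nonneg hδ0 hρ0).trans hκ
  obtain ⟨V, hV, hVA⟩ := exists_subspace_sv_sq_le A hj (hjk.trans hkn)
  have h3 : sv A j ^ 2 - δ ≤ sv F.approx j ^ 2 := by
    refine le_sv_sq_of_subspace _ V hj hV.ge fun x hx => ?_
    have hx1 := hVA x hx
    rw [F.mulVec_dot_self, sub_approx_mulVec] at hx1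
    have hx2 := mulVec_dot_self_le F.D (F.snd x)
    have hx3 : F.snd x ⬝ᵥ F.snd x ≤ x ⬝ᵥ x := by
      rw [F.dotProduct_eq_add x x]; linarith [dot_self_nonneg (F.fst x)]
    have hx4 := mul_le_mul_of_nonneg_left hx3 hδ0
    linarith
  nlinarith

/-- The singular values of the residual are controlled by the trailing ones of `A`. If `V` is a
`j`-dimensional space on which the residual is bounded below by `σ = σ_j(A - F.approx)`, then
`F.lift α` maps `ℝᵏ × V` to a space of dimension `k + j` on which `A` is bounded below by
`σ / √(1 + κ)`. -/
theorem sv_sub_approx_sq_le {L : Matrix (Fin k) (Fin m) ℝ} (hL : L * F.C = 1) {κ : ℝ}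
    (hκ : (∑ i, ∑ j, F.D i j ^ 2) * (∑ i, ∑ s, L i s ^ 2) + ∑ i, ∑ j, F.W i j ^ 2 ≤ κ) {j : ℕ}
    (hj : 1 ≤ j) (hjn : j ≤ n) :
    sv (A - F.approx) j ^ 2 ≤ (1 + κ) * sv A (k + j) ^ 2 := by
  set E := A - F.approx with hE
  set δ := ∑ i, ∑ j, F.D i j ^ 2 with hδ
  set ρ := ∑ i, ∑ s, L i s ^ 2 with hρ
  have hδ0 : 0 ≤ δ := by positivity
  have hρ0 : 0 ≤ ρ := by positivity
  have hω0 : 0 ≤ ∑ i, ∑ j, F.W i j ^ 2 := by positivity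
  have hκ0 : 0 ≤ κ := by nlinarith
  rcases (sv_nonneg E j).eq_or_lt with h0 | hpos
  · rw [← h0]
    rw [zero_pow two_ne_zero]; positivity
  obtain ⟨V, hV, hVE⟩ := exists_subspace_sv_sq_le E hj hjn
  set σ := sv E j
  have hσδ : σ ^ 2 ≤ δ := by
    obtain ⟨x, hx, hx0⟩ := V.exists_mem_ne_zero_of_ne_bot (by
      rintro rfl
      rw [finrank_bot] at hV
      omega)
    have hxpos : 0 < x ⬝ᵥ x := (dot_self_nonneg x).lt_of_ne' (by simpa using hx0)
    refine le_of_mul_le_mul_right ((hVE x hx).trans ?_) hxpos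
    rw [hE, sub_approx_mulVec]
    refine (mulVec_dot_self_le F.D _).trans (mul_le_mul_of_nonneg_left ?_ hδ0)
    rw [F.dotProduct_eq_add x x]; linarith [dot_self_nonneg (F.fst x)]
  -- With this `α`, the vectors `α C z` are at least as long as `σ z`.
  set α := √(δ * ρ)
  have hα : α ^ 2 = δ * ρ := Real.sq_sqrt (mul_nonneg hδ0 hρ0)
  have hlow : ∀ z, ∀ x ∈ V, σ ^ 2 * (z ⬝ᵥ z + x ⬝ᵥ x) ≤
      (A *ᵥ F.lift α (z, x)) ⬝ᵥ (A *ᵥ F.lift α (z, x)) := by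
    intro z x hx
    rw [mulVec_lift_dot_self, hα]
    have h1 := hVE x hx
    have h2 := mul_le_mul_of_nonneg_left (F.le_mul_dot_of_leftInverse hL z) hδ0
    have h3 := mul_le_mul_of_nonneg_right hσδ (dot_self_nonneg z)
    rw [← hρ] at h2
    linarith
  let S : ((Fin k → ℝ) × V) →ₗ[ℝ] (Fin n → ℝ) :=
    F.lift α ∘ₗ LinearMap.prodMap LinearMap.id V.subtype
  have hS : ∀ z (x : V), S (z, x) = F.lift α (z, x) := fun _ _ => rfl
  have hinj : Function.Injective S := by
    rw [← LinearMap.ker_eq_bot, LinearMap.ker_eq_bot']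
    rintro ⟨z, x⟩ h
    have h1 := hlow z x x.2
    rw [← hS, h, mulVec_zero, zero_dotProduct] at h1
    have h2 : z ⬝ᵥ z + (x : Fin n → ℝ) ⬝ᵥ x ≤ 0 := by
      by_contra! hc
      exact absurd h1 (not_le.2 (by positivity))
    have hz := dot_self_nonneg z
    have hx := dot_self_nonneg (x : Fin n → ℝ)
    have hz0 : z = 0 := dotProduct_self_eq_zero.1 (by linarith)
    have hx0 : (x : Fin n → ℝ) = 0 := dotProduct_self_eq_zero.1 (by linarith)
    simp only [Prod.mk_eq_zero]
    exact ⟨hz0, Subtype.ext hx0⟩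
  have key : σ ^ 2 / (1 + κ) ≤ sv A (k + j) ^ 2 := by
    refine le_sv_sq_of_subspace A (LinearMap.range S) (by omega) ?_ ?_
    · rw [LinearMap.finrank_range_of_inj hinj, Module.finrank_prod, hV, Module.finrank_fin_fun]
    · rintro _ ⟨⟨z, x⟩, rfl⟩
      refine le_trans ?_ (hlow z x x.2)
      rw [hS, div_mul_eq_mul_div, div_le_iff₀ (by positivity), mul_assoc]
      refine mul_le_mul_of_nonneg_left ?_ (sq_nonneg _)
      have hzx : 0 ≤ z ⬝ᵥ z + (x : Fin n → ℝ) ⬝ᵥ x :=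
        add_nonneg (dot_self_nonneg _) (dot_self_nonneg _)
      refine (F.lift_dot_self_le α z x).trans ?_
      rw [mul_comm _ (1 + κ), hα]
      exact mul_le_mul_of_nonneg_right (by linarith) hzx
  rwa [div_le_iff₀ (by positivity), mul_comm] at key

end InterpDecomp

/-! ### Local maximum volume in an interpolative decomposition -/

namespace InterpDecomp

variable {m n k l : ℕ} {A : Matrix (Fin m) (Fin n) ℝ} (F : InterpDecomp A k l)

/-- The indices of the columns of `A` that form `C`. -/
def cols : Fin k ↪ Fin n := Function.Embedding.inl.trans F.perm.toEmbedding

theorem submatrix_cols : A.submatrix id F.cols = F.C := by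
  ext r c
  exact congrFun (congrFun F.eq r) (Sum.inl c)

theorem col_inr (j : Fin l) (r : Fin m) :
    A r (F.perm (Sum.inr j)) = (F.C * F.W + F.D) r j :=
  congrFun (congrFun F.eq r) (Sum.inr j)

/-- The selection of columns that differs from `F.cols` in column `i`, which is exchanged for
column `j` of the others. -/
def exchange (i : Fin k) (j : Fin l) : Fin k ↪ Fin n where
  toFun := Function.update F.cols i (F.perm (Sum.inr j))
  inj' := by
    have h : ∀ s, F.cols s ≠ F.perm (Sum.inr j) := fun s h => by
      simpa using F.perm.injective h
    intro s t hst
    by_cases hs : s = i <;> by_cases ht : t = i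
    · rw [hs, ht]
    · subst hs
      rw [Function.update_self, Function.update_of_ne ht] at hst
      exact absurd hst.symm (h t)
    · subst ht
      rw [Function.update_self, Function.update_of_ne hs] at hst
      exact absurd hst (h s)
    · rw [Function.update_of_ne hs, Function.update_of_ne ht] at hst
      exact F.cols.injective hst

theorem exchange_self (i : Fin k) (j : Fin l) : F.exchange i j i = F.perm (Sum.inr j) :=
  Function.update_self ..

theorem exchange_of_ne {i s : Fin k} (hs : s ≠ i) (j : Fin l) : F.exchange i j s = F.cols s :=
  Function.update_of_ne hs ..

theorem submatrix_exchange (i : Fin k) (j : Fin l) :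
    A.submatrix id (F.exchange i j) = F.C.updateCol i ((F.C * F.W + F.D).col j) := by
  ext r c
  by_cases hc : c = i
  · subst hc
    rw [submatrix_apply, exchange_self, updateCol_self]
    exact F.col_inr j r
  · rw [submatrix_apply, F.exchange_of_ne hc, updateCol_ne hc]
    exact congrFun (congrFun F.submatrix_cols r) c

theorem card_exchange_sdiff_le (i : Fin k) (j : Fin l) :
    (Finset.univ.map (F.exchange i j) \ Finset.univ.map F.cols).card ≤ 1 := by
  refine (Finset.card_le_card (t := {F.perm (Sum.inr j)}) fun x hx => ?_).trans_eq
    (Finset.card_singleton _)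
  obtain ⟨h1, h2⟩ := Finset.mem_sdiff.1 hx
  obtain ⟨s, -, rfl⟩ := Finset.mem_map.1 h1
  by_cases hs : s = i
  · rw [hs, exchange_self]; exact Finset.mem_singleton_self _
  · refine absurd (Finset.mem_map.2 ⟨s, Finset.mem_univ _, ?_⟩) h2
    exact (F.exchange_of_ne hs j).symm

theorem gram_det_pos (hkm : k ≤ m) (h : IsLocalMaxVol A (Function.Embedding.refl _) F.cols) :
    0 < (F.Cᵀ * F.C).det := by
  rw [← vol_sq hkm, ← submatrix_cols]
  exact pow_pos h.vol_pos 2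

theorem entry_bound (hkm : k ≤ m) (h : IsLocalMaxVol A (Function.Embedding.refl _) F.cols)
    (i : Fin k) (j : Fin l) :
    F.W i j ^ 2 + (∑ r, F.D r j ^ 2) * (∑ s, ((F.Cᵀ * F.C)⁻¹ * F.Cᵀ) i s ^ 2) ≤ 1 := by
  refine sq_add_mul_le_one_of_gram_le F.orth (F.gram_det_pos hkm h) i j ?_
  rw [← submatrix_exchange, ← vol_sq hkm, ← vol_sq hkm, ← F.submatrix_cols]
  exact pow_le_pow_left₀ (vol_nonneg _) (h.vol_le (Function.Embedding.refl _) _ (by simp)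
    (F.card_exchange_sdiff_le i j)) 2

/-- Summing `entry_bound` over all exchanges gives the bound that both comparisons of singular
values need, with `κ = k l`. -/
theorem total_bound (hkm : k ≤ m) (h : IsLocalMaxVol A (Function.Embedding.refl _) F.cols) :
    (∑ i, ∑ j, F.D i j ^ 2) * (∑ i, ∑ s, ((F.Cᵀ * F.C)⁻¹ * F.Cᵀ) i s ^ 2) +
      ∑ i, ∑ j, F.W i j ^ 2 ≤ k * l := by
  rw [Finset.sum_comm, mul_comm, Finset.sum_mul_sum, ← Finset.sum_add_distrib]
  calc _ ≤ ∑ i : Fin k, ∑ j : Fin l, (1 : ℝ) := by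
        refine Finset.sum_le_sum fun i _ => ?_
        rw [← Finset.sum_add_distrib]
        refine Finset.sum_le_sum fun j _ => ?_
        linarith [F.entry_bound hkm h i j]
    _ = k * l := by simp

/-- The pseudoinverse `(Cᵀ C)⁻¹ Cᵀ` is a left inverse of `C`. -/
theorem leftInverse (h : 0 < (F.Cᵀ * F.C).det) : ((F.Cᵀ * F.C)⁻¹ * F.Cᵀ) * F.C = 1 := by
  rw [Matrix.mul_assoc, nonsing_inv_mul _ h.ne'.isUnit]

end InterpDecomp

/-! ### Partial QR factorizations -/

namespace PartialQR

variable {m n k : ℕ} {A : Matrix (Fin m) (Fin n) ℝ} (F : PartialQR A k)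

theorem steps_le_rows (F : PartialQR A k) : k ≤ m := by
  have h := rank_mul_le_right F.Q₁ᵀ F.Q₁
  rw [F.orthonormal, rank_one, Fintype.card_fin] at h
  exact h.trans F.Q₁.rank_le_height

theorem submatrix_perm : A.submatrix id F.perm =
    fromCols (F.Q₁ * F.R₁₁) (F.Q₁ * F.R₁₂ + F.Q₂ * F.R₂₂) := by
  rw [F.factorization, fromCols_mul_fromBlocks, Matrix.mul_zero, add_zero]

theorem submatrix_pivotCols : A.submatrix id F.pivotCols = F.Q₁ * F.R₁₁ := by
  ext r c
  exact congrFun (congrFun F.submatrix_perm r) (Sum.inl c)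

theorem isUnit_det_of_hasLocalMaxVolPivot (h : F.HasLocalMaxVolPivot) : IsUnit F.R₁₁.det := by
  have h1 : 0 < vol (A.submatrix id F.pivotCols) ^ 2 := pow_pos h.vol_pos 2
  rw [vol_sq F.steps_le_rows, submatrix_pivotCols, transpose_mul, Matrix.mul_assoc,
    ← Matrix.mul_assoc F.Q₁ᵀ, F.orthonormal, Matrix.one_mul, det_mul, det_transpose] at h1
  exact (left_ne_zero_of_mul h1.ne').isUnit

/-- A partial QR factorization with invertible `R₁₁` is an interpolative decomposition, with
coefficients `R₁₁⁻¹ R₁₂`. -/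
noncomputable def toInterpDecomp (h : IsUnit F.R₁₁.det) : InterpDecomp A k (n - k) where
  perm := F.perm
  C := F.Q₁ * F.R₁₁
  W := F.R₁₁⁻¹ * F.R₁₂
  D := F.Q₂ * F.R₂₂
  orth := by rw [transpose_mul, Matrix.mul_assoc, F.orthogonal, Matrix.mul_zero]
  eq := by
    rw [F.submatrix_perm, Matrix.mul_assoc F.Q₁, mul_nonsing_inv_cancel_left _ _ h]

theorem approx_toInterpDecomp (h : IsUnit F.R₁₁.det) : (F.toInterpDecomp h).approx = F.approx := by
  rw [InterpDecomp.approx, approx, toInterpDecomp, Matrix.mul_assoc, mul_fromCols, Matrix.mul_one,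
    mul_nonsing_inv_cancel_left _ _ h]

end PartialQR

/-! ### Existence of an output -/

/-- Permuting all the rows of a submatrix does not change its volume. -/
theorem vol_submatrix_embedding_rows {m n k : ℕ} (hk : k ≤ m) (A : Matrix (Fin m) (Fin n) ℝ)
    (f : Fin m ↪ Fin m) (g : Fin k ↪ Fin n) : vol (A.submatrix f g) = vol (A.submatrix id g) := by
  have hf : Function.Bijective f := Finite.injective_iff_bijective.1 f.injective
  rw [← sq_eq_sq₀ (vol_nonneg _) (vol_nonneg _), vol_sq hk, vol_sq hk]
  congr 1
  ext i j
  simp only [mul_apply, transpose_apply, submatrix_apply, id]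
  exact (Equiv.ofBijective f hf).sum_comp fun r => A r (g i) * A r (g j)

theorem vol_pos_of_linearIndependent {m k : ℕ} (C : Matrix (Fin m) (Fin k) ℝ)
    (h : LinearIndependent ℝ C.col) : 0 < vol C := by
  have hk : k ≤ m := by simpa using h.fintype_card_le_finrank
  have := (PosDef.conjTranspose_mul_self C (mulVec_injective_iff.2 h)).det_pos
  rw [conjTranspose_eq_transpose_of_trivial, ← vol_sq hk] at this
  exact (vol_nonneg C).lt_of_ne' fun h0 => by simp [h0] at this

theorem linearIndependent_of_vol_pos {m k : ℕ} (hk : k ≤ m) (C : Matrix (Fin m) (Fin k) ℝ)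
    (h : 0 < vol C) : LinearIndependent ℝ C.col := by
  rw [← mulVec_injective_iff]
  have hdet : IsUnit (Cᵀ * C).det := by
    rw [← vol_sq hk]
    exact (pow_pos h 2).ne'.isUnit
  have := mulVec_injective_of_isUnit ((isUnit_iff_isUnit_det _).2 hdet)
  intro x y hxy
  apply this
  simp only [← mulVec_mulVec]
  exact congrArg _ hxy

theorem exists_embedding_linearIndependent_col {m n r : ℕ} (A : Matrix (Fin m) (Fin n) ℝ)
    (hr : r ≤ A.rank) : ∃ g : Fin r ↪ Fin n, LinearIndependent ℝ (A.submatrix id g).col := by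
  obtain ⟨κ, a, ha, hsp, hli⟩ := exists_linearIndependent' ℝ A.col
  have : Fintype κ := Fintype.ofInjective a ha
  have hcard : Fintype.card κ = A.rank := by
    rw [← finrank_span_eq_card hli, hsp, rank_eq_finrank_span_cols]
  obtain ⟨b⟩ : Nonempty (Fin r ↪ κ) := Function.Embedding.nonempty_of_card_le (by simpa [hcard])
  exact ⟨b.trans ⟨a, ha⟩, hli.comp b b.injective⟩

theorem exists_isLocalMaxVol {m n r : ℕ} (A : Matrix (Fin m) (Fin n) ℝ) (hr : r ≤ A.rank) :
    ∃ g : Fin r ↪ Fin n, IsLocalMaxVol A (Function.Embedding.refl _) g := by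
  obtain ⟨g₀, hg₀⟩ := exists_embedding_linearIndependent_col A hr
  have : Nonempty (Fin r ↪ Fin n) := ⟨g₀⟩
  obtain ⟨g, hg⟩ := Finite.exists_max fun g : Fin r ↪ Fin n => vol (A.submatrix id g)
  refine ⟨g, (vol_pos_of_linearIndependent _ hg₀).trans_le (hg g₀), fun f' g' _ _ => ?_⟩
  rw [vol_submatrix_embedding_rows (hr.trans A.rank_le_height)]
  exact hg g'

/-- Every selection of `r` columns is the first block of some permutation of the columns. -/
theorem exists_sum_equiv_extending {n r : ℕ} (g : Fin r ↪ Fin n) :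
    ∃ e : Fin r ⊕ Fin (n - r) ≃ Fin n, ∀ i, e (Sum.inl i) = g i := by
  classical
  have hcard : Fintype.card {x // x ∉ Set.range g} = n - r := by
    rw [Fintype.card_subtype_compl, Fintype.card_fin]
    have := Fintype.card_congr (Equiv.ofInjective g g.injective)
    rw [Fintype.card_fin] at this
    exact congrArg _ (this.symm.trans rfl)
  refine ⟨((Equiv.ofInjective g g.injective).sumCongr (Fintype.equivFinOfCardEq hcard).symm).trans
    (Equiv.sumCompl (· ∈ Set.range g)), fun i => ?_⟩
  simp

/-- The QR factorization of a matrix with linearly independent columns, by the Gram–Schmidt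
process. -/
theorem exists_qr {m k : ℕ} (C : Matrix (Fin m) (Fin k) ℝ) (h : LinearIndependent ℝ C.col) :
    ∃ (Q : Matrix (Fin m) (Fin k) ℝ) (R : Matrix (Fin k) (Fin k) ℝ),
      (∀ i j, j < i → R i j = 0) ∧ Qᵀ * Q = 1 ∧ C = Q * R := by
  let v : Fin k → EuclideanSpace ℝ (Fin m) := fun j => WithLp.toLp 2 (C.col j)
  have hv : LinearIndependent ℝ v :=
    h.map' (WithLp.linearEquiv 2 ℝ (Fin m → ℝ)).symm.toLinearMap (LinearEquiv.ker _)
  let u := InnerProductSpace.gramSchmidtNormed ℝ v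
  have hu : Orthonormal ℝ u := InnerProductSpace.gramSchmidtNormed_orthonormal hv
  refine ⟨of fun i j => u j i, of fun i j => inner ℝ (u i) (v j), fun i j hij => ?_, ?_, ?_⟩
  · simp [u, InnerProductSpace.gramSchmidtNormed, real_inner_smul_left,
      InnerProductSpace.gramSchmidt_inv_triangular ℝ v hij]
  · ext i j
    have := orthonormal_iff_ite.1 hu i j
    rw [one_apply, ← this]
    simp [mul_apply, PiLp.inner_apply, mul_comm]
  · ext r j
    have hmem : v j ∈ Submodule.span ℝ (Set.range u) := by
      rw [InnerProductSpace.span_gramSchmidtNormed_range, InnerProductSpace.span_gramSchmidt]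
      exact Submodule.subset_span ⟨j, rfl⟩
    obtain ⟨c, hc⟩ := (Submodule.mem_span_range_iff_exists_fun ℝ).1 hmem
    have hci : ∀ i, inner ℝ (u i) (v j) = c i := by
      intro i
      rw [← hc, hu.inner_right_fintype]
    have := congrArg (fun w => w.ofLp r) hc
    simp only [WithLp.ofLp_sum, Finset.sum_apply, WithLp.ofLp_smul, Pi.smul_apply, smul_eq_mul]
      at this
    simp only [mul_apply, of_apply, hci]
    rw [show C r j = (v j).ofLp r from rfl, ← this]
    exact Finset.sum_congr rfl fun i _ => mul_comm _ _

/-- Rank factorization, with any inner dimension from the rank on. -/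
theorem exists_mul_of_rank_le {m l p : ℕ} (D : Matrix (Fin m) (Fin l) ℝ) (h : D.rank ≤ p) :
    ∃ (X : Matrix (Fin m) (Fin p) ℝ) (Y : Matrix (Fin p) (Fin l) ℝ), D = X * Y := by
  obtain ⟨φ, hφ⟩ := (finrank_le_iff_exists_linearMap (R := ℝ)
    (M := LinearMap.range D.mulVecLin) (M' := Fin p → ℝ)).1 (by simpa [Matrix.rank] using h)
  obtain ⟨ψ, hψ⟩ := φ.exists_leftInverse_of_injective (LinearMap.ker_eq_bot.2 hφ)
  refine ⟨LinearMap.toMatrix' ((LinearMap.range D.mulVecLin).subtype ∘ₗ ψ),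
    LinearMap.toMatrix' (φ ∘ₗ D.mulVecLin.rangeRestrict), ?_⟩
  rw [← LinearMap.toMatrix'_comp, LinearMap.comp_assoc, ← LinearMap.comp_assoc _ φ ψ, hψ,
    LinearMap.id_comp]
  exact (LinearMap.toMatrix'_toLin' D).symm

/-- Any linearly independent columns can serve as the pivot. The remainder is orthogonal to the
`r`-dimensional range of `Q₁` and has `n - r` columns, so its rank is at most `min m n - r`, the
inner dimension that `PartialQR` prescribes. -/
theorem PartialQR.exists_of_linearIndependent {m n r : ℕ} (A : Matrix (Fin m) (Fin n) ℝ)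
    (g : Fin r ↪ Fin n) (h : LinearIndependent ℝ (A.submatrix id g).col) :
    ∃ F : PartialQR A r, F.pivotCols = g := by
  obtain ⟨e, he⟩ := exists_sum_equiv_extending g
  obtain ⟨Q, R, hR, hQ, hC⟩ := exists_qr _ h
  set A₂ := A.submatrix id (e ∘ Sum.inr) with hA₂
  set D := A₂ - Q * (Qᵀ * A₂) with hD
  have hQD : Qᵀ * D = 0 := by
    rw [hD, Matrix.mul_sub, ← Matrix.mul_assoc, hQ, Matrix.one_mul, sub_self]
  have hrank : D.rank ≤ min m n - r := by
    have h1 := rank_add_rank_le_card_of_mul_eq_zero hQD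
    have h2 : Qᵀ.rank = r := by
      rw [rank_transpose, ← rank_transpose_mul_self, hQ, rank_one, Fintype.card_fin]
    have h3 := D.rank_le_width
    rw [h2, Fintype.card_fin] at h1
    omega
  obtain ⟨X, Y, hXY⟩ := exists_mul_of_rank_le D hrank
  refine ⟨⟨e, Q, X, R, Qᵀ * A₂, Y, hR, hQ, by rw [← hXY, hQD], ?_⟩, ?_⟩
  · rw [fromCols_mul_fromBlocks, Matrix.mul_zero, add_zero, ← hXY, ← hC, hD, add_sub_cancel]
    ext i (j | j)
    · simp [he]
    · simp [hA₂]
  · ext i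
    simp [PartialQR.pivotCols, he]

theorem qrLocalMaxVol_nonempty (m n : ℕ) (A : Matrix (Fin m) (Fin n) ℝ) (k : ℕ) :
    (qrLocalMaxVol m n A k).Nonempty := by
  have hr : min k A.rank ≤ A.rank := min_le_right _ _
  obtain ⟨g, hg⟩ := exists_isLocalMaxVol A hr
  obtain ⟨F, hF⟩ := PartialQR.exists_of_linearIndependent A g
    (linearIndependent_of_vol_pos (hr.trans A.rank_le_height) _ hg.vol_pos)
  exact ⟨F.approx, F, by rwa [PartialQR.HasLocalMaxVolPivot, hF], rfl⟩

/-! ### The rank-revealing bounds -/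

namespace PartialQR

variable {m n k : ℕ} {A : Matrix (Fin m) (Fin n) ℝ} (F : PartialQR A k)

theorem interpolativeBound_of_hasLocalMaxVolPivot (h : F.HasLocalMaxVolPivot) :
    F.InterpolativeBound 1 := by
  have hR := F.isUnit_det_of_hasLocalMaxVolPivot h
  refine ⟨hR, fun i j => abs_le_one_iff_mul_self_le_one.2 ?_⟩
  have h1 := (F.toInterpDecomp hR).entry_bound F.steps_le_rows h i j
  rw [← sq]
  exact (le_add_of_nonneg_right (by positivity)).trans h1

theorem rank_approx_le : F.approx.rank ≤ k := by
  refine (rank_submatrix_le _ _ _).trans ((rank_mul_le_left _ _).trans ?_)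
  exact F.Q₁.rank_le_width

theorem sv_approx_le (h : F.HasLocalMaxVolPivot) {j : ℕ} (hj : 1 ≤ j) (hjn : j ≤ n) :
    sv F.approx j ≤ sv A j := by
  have hR := F.isUnit_det_of_hasLocalMaxVolPivot h
  rw [← F.approx_toInterpDecomp hR]
  refine sv_le_sv_of_mulVec_le (fun x => ?_) hj hjn
  rw [(F.toInterpDecomp hR).mulVec_dot_self x]
  exact le_add_of_nonneg_right (dot_self_nonneg _)

theorem sv_sq_le (h : F.HasLocalMaxVolPivot) {j : ℕ} (hj : 1 ≤ j) (hjk : j ≤ k) :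
    sv A j ^ 2 ≤ (1 + k * ↑(n - k)) * sv F.approx j ^ 2 := by
  have hR := F.isUnit_det_of_hasLocalMaxVolPivot h
  set G := F.toInterpDecomp hR
  rw [← F.approx_toInterpDecomp hR]
  have hL := G.leftInverse (G.gram_det_pos F.steps_le_rows h)
  refine G.sv_sq_le_mul_sv_approx_sq hL ?_ hj hjk
  refine le_trans (le_add_of_nonneg_right ?_) (G.total_bound F.steps_le_rows h)
  positivity

theorem sv_sub_approx_sq_le (h : F.HasLocalMaxVolPivot) {j : ℕ} (hj : 1 ≤ j) (hjn : j ≤ n) :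
    sv (A - F.approx) j ^ 2 ≤ (1 + k * ↑(n - k)) * sv A (k + j) ^ 2 := by
  have hR := F.isUnit_det_of_hasLocalMaxVolPivot h
  set G := F.toInterpDecomp hR
  rw [← F.approx_toInterpDecomp hR]
  have hL := G.leftInverse (G.gram_det_pos F.steps_le_rows h)
  exact G.sv_sub_approx_sq_le hL (G.total_bound F.steps_le_rows h) hj hjn

end PartialQR

theorem le_mul_of_sq_le {a b c d : ℝ} (hd : 0 ≤ d) (hb : 0 ≤ b) (hcd : c ≤ d ^ 2)
    (h : a ^ 2 ≤ c * b ^ 2) : a ≤ d * b := by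
  refine le_of_sq_le_sq (h.trans ?_) (mul_nonneg hd hb)
  rw [mul_pow]
  exact mul_le_mul_of_nonneg_right hcd (sq_nonneg b)

/-- The two-sided bounds after `r = min k A.rank` steps. When `r < k`, the singular values of `A`
with index above `r` vanish, so the bounds for `r` give those for `k`. -/
theorem PartialQR.sv_bounds {m n k r : ℕ} {A : Matrix (Fin m) (Fin n) ℝ} (hr : r = min k A.rank)
    (hkmn : k ≤ min m n) (F : PartialQR A r) (hF : F.HasLocalMaxVolPivot) {μ : ℝ} (hμ : 1 ≤ μ)
    (hrμ : (1 + r * ↑(n - r) : ℝ) ≤ μ ^ 2) :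
    (∀ j : ℕ, 1 ≤ j → j ≤ k → 1 / μ * sv A j ≤ sv F.approx j ∧ sv F.approx j ≤ μ * sv A j) ∧
    (∀ j : ℕ, 1 ≤ j → j ≤ min m n - k →
      1 / μ * sv A (k + j) ≤ sv (A - F.approx) j ∧ sv (A - F.approx) j ≤ μ * sv A (k + j)) := by
  have hrk : r ≤ k := hr ▸ min_le_left _ _
  have hμinv : ∀ a b : ℝ, a ≤ μ * b → 1 / μ * a ≤ b := by
    intro a b hab
    rwa [one_div, inv_mul_le_iff₀ (by linarith)]
  have hself : ∀ a : ℝ, 0 ≤ a → a ≤ μ * a := fun a ha =>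
    le_mul_of_one_le_left ha hμ
  refine ⟨fun j hj hjk => ⟨hμinv _ _ ?_, ?_⟩,
    fun j hj hjk => ⟨hμinv _ _ ?_, ?_⟩⟩
  · rcases le_or_gt j r with hjr | hjr
    · exact le_mul_of_sq_le (by linarith) (sv_nonneg _ _) hrμ (F.sv_sq_le hF hj hjr)
    · rw [sv_eq_zero_of_rank_lt A (by omega)]
      exact mul_nonneg (by linarith) (sv_nonneg _ _)
  · exact (F.sv_approx_le hF hj (by omega)).trans (hself _ (sv_nonneg _ _))
  · exact (sv_add_rank_le A F.approx (F.rank_approx_le.trans hrk) hj (by omega)).trans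
      (hself _ (sv_nonneg _ _))
  · have h1 := F.sv_sub_approx_sq_le hF hj (by omega : j ≤ n)
    have h2 : sv A (r + j) = sv A (k + j) := by
      rcases le_or_gt k A.rank with hkr | hkr
      · rw [hr, min_eq_left hkr]
      · rw [sv_eq_zero_of_rank_lt A (by omega), sv_eq_zero_of_rank_lt A (by omega)]
    rw [h2] at h1
    exact le_mul_of_sq_le (by linarith) (sv_nonneg _ _) hrμ h1

theorem mainTheorem2 :
    IsRankRevealer qrLocalMaxVol (fun _ n k => Real.sqrt (1 + 5 * (k : ℝ) * (n : ℝ))) ∧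
    ∀ (m n k : ℕ) (A : Matrix (Fin m) (Fin n) ℝ) (F : PartialQR A k),
      F.HasLocalMaxVolPivot → F.InterpolativeBound 1 := by
  refine ⟨⟨⟨1 + 5 * MvPolynomial.X 2 * MvPolynomial.X 1, fun m n k => ?_⟩,
    fun m n A k hk hkmn => ?_⟩, fun m n k A F h => F.interpolativeBound_of_hasLocalMaxVolPivot h⟩
  · have h1 : (1 : ℝ) ≤ 1 + 5 * k * n := le_add_of_nonneg_right (by positivity)
    simpa using Real.sqrt_le_iff.2 ⟨by linarith, le_self_pow₀ h1 two_ne_zero⟩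
  have hμ : 1 ≤ √(1 + 5 * (k : ℝ) * n) :=
    Real.one_le_sqrt.2 (le_add_of_nonneg_right (by positivity))
  refine ⟨hμ, qrLocalMaxVol_nonempty m n A k, ?_⟩
  rintro _ ⟨F, hF, rfl⟩
  have hrk := min_le_left k A.rank
  have hle : (1 + ↑(min k A.rank) * ↑(n - min k A.rank) : ℝ) ≤ √(1 + 5 * k * n) ^ 2 := by
    have h1 : ((min k A.rank : ℕ) : ℝ) ≤ k := by exact_mod_cast hrk
    have h2 : ((n - min k A.rank : ℕ) : ℝ) ≤ n := by exact_mod_cast Nat.sub_le n (min k A.rank)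
    have h3 := mul_le_mul h1 h2 (by positivity) (by positivity)
    have h4 : (0 : ℝ) ≤ k * n := by positivity
    rw [Real.sq_sqrt (by positivity)]
    linarith
  exact ⟨F.rank_approx_le.trans hrk, F.sv_bounds rfl hkmn hF hμ hle⟩
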